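/- For a positive integer $n$, let $P_n$ be the path on vertices labelled $1,\dots,n$ (consecutive labels adjacent), let $A$ be its adjacency matrix, and let $U(\tau)=e^{iA\tau}$ for real $\tau$. Let $|1\rangle,\dots,|n\rangle$ be the standard basis of $\mathbb{C}^n$. A state is a unit vector of $\mathbb{C}^n$. There is pretty good state transfer in $P_n$ between states $|\mathbf v\rangle$ and $|\mathbf w\rangle$ if for every $\epsilon>0$ there is a time $\tau>0$ with $|\langle \mathbf w|U(\tau)|\mathbf v\rangle|>1-\epsilon$. The mirror state of $|\mathbf v\rangle=\sum_{j=1}^n\beta_j|j\rangle$ is $|\mathbf v^\sigma\rangle=\sum_{j=1}^n\beta_{n+1-j}|j\rangle$. **Corollary.** Let $p$ be an odd prime, let $t\ge 2$ be an integer, and let $n=2^tp-1$. Let $a,b\in\{1,\dots,n\}$ with $a\ne b$, let $\alpha\in\{1,-1\}$, and suppose that $a+\alpha b\equiv 0\pmod{2^t}$. Put $$|\mathbf v\rangle=\tfrac{1}{\sqrt2}\bigl(|a\rangle+\alpha|b\rangle\bigr).$$ Then $|\mathbf v\rangle$ has mirror state $$|\mathbf v^\sigma\rangle=\tfrac{1}{\sqrt2}\bigl(|2^tp-a\rangle+\alpha|2^tp-b\rangle\bigr),$$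 and there is pretty good state transfer in $P_n$ between the states $|\mathbf v\rangle$ and $|\mathbf v^\sigma\rangle$. -/

import Mathlib

open Matrix

namespace StateTransfer

noncomputable section

/-- The transition operator `U(τ) = exp(i τ A)` of a graph, where `A` is its adjacency matrix. -/
def transition {V : Type*} [Fintype V] [DecidableEq V] (G : SimpleGraph V) [DecidableRel G.Adj]
    (τ : ℝ) : Matrix V V ℂ :=
  NormedSpace.exp ((Complex.I * (τ : ℂ)) • G.adjMatrix ℂ)

/-- A vector of amplitudes is a (pure, single-excitation) state if it is normalized. -/
def IsState {V : Type*} [Fintype V] (v : V → ℂ) : Prop :=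
  ∑ x, ‖v x‖ ^ 2 = 1

/-- Pretty good state transfer in `G` between the states `v` and `w`: for every `ε > 0` there is a
time `τ > 0` with `|⟨w| U(τ) |v⟩| > 1 - ε`. -/
def PrettyGoodStateTransfer {V : Type*} [Fintype V] [DecidableEq V] (G : SimpleGraph V)
    [DecidableRel G.Adj] (v w : V → ℂ) : Prop :=
  IsState v ∧ IsState w ∧
    ∀ ε : ℝ, 0 < ε → ∃ τ : ℝ, 0 < τ ∧ 1 - ε < ‖star w ⬝ᵥ (transition G τ *ᵥ v)‖

/-- The basis state `|a⟩` of the path on `n` vertices labelled `1, …, n`; the element `j` of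
`Fin n` carries the label `j + 1`. -/
def ket (n a : ℕ) : Fin n → ℂ :=
  fun j => if (j : ℕ) + 1 = a then 1 else 0

/-- The vector `(|a⟩ + α |b⟩) / √2` on the path on `n` vertices. -/
def pairState (n a b : ℕ) (α : ℤ) : Fin n → ℂ :=
  ((Real.sqrt 2 : ℝ) : ℂ)⁻¹ • (ket n a + (α : ℂ) • ket n b)

/-- The mirror state of `v`: its amplitude at label `j` is that of `v` at label `n + 1 - j`. -/
def mirror {n : ℕ} (v : Fin n → ℂ) : Fin n → ℂ :=
  fun j => v (Fin.rev j)

/-- Adjacency in the path `0 - 1 - ⋯ - (n - 1)` is decidable. -/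
instance pathGraphDecidable (n : ℕ) : DecidableRel (SimpleGraph.pathGraph n).Adj :=
  fun _ _ => decidable_of_iff' _ SimpleGraph.pathGraph_adj

end

end StateTransfer

namespace StateTransfer

open Filter Topology

/-! Put `N = 2 ^ t * p = n + 1`. The path has the simple eigenvalues `2 cos (π k / N)`, `1 ≤ k ≤ n`,
with sine eigenvectors, and mirroring multiplies the `k`-th eigencomponent by `(-1) ^ (k - 1)`. So
the overlap of `U(τ) v` with the mirror state is a convex combination of the `exp (i τ θ_k)` with
these signs.

By a Kronecker-type argument (`exists_lt_norm_sum_mul_exp`) its modulus comes arbitrarily close to 1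
if no integer relation between the eigenvalues in the support of `v` contradicts the signs. The
congruence on `a` and `b` removes from the support every `k` divisible by `2p`
(`spectralWeight_pairState_eq_zero`).

A relation supported on the remaining `k` is a polynomial vanishing at a primitive `2N`-th root of
unity. Divisibility by the cyclotomic polynomial makes its coefficients antiperiodic with period `2
^ t`, and the zeros at multiples of `2p` then spread to all even indices. This gives the required
parity (`even_sum_of_sum_mul_cos_eq_zero`). -/

/-! ### Mean values of exponential sums and Kronecker-type approximation -/

theorem tendsto_average_cos (μ : ℝ) :
    Tendsto (fun T : ℝ => T⁻¹ * ∫ x in (0 : ℝ)..T, Real.cos (x * μ)) atTop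
      (𝓝 (if μ = 0 then 1 else 0)) := by
  split_ifs with h
  · refine tendsto_const_nhds.congr' ?_
    filter_upwards [eventually_gt_atTop 0] with T hT
    simp [h, hT.ne']
  · have hint (T : ℝ) : ∫ x in (0 : ℝ)..T, Real.cos (x * μ) = μ⁻¹ * Real.sin (T * μ) := by
      rw [intervalIntegral.integral_comp_mul_right (fun y => Real.cos y) h]
      simp
    simp_rw [hint]
    refine tendsto_inv_atTop_zero.zero_mul_isBoundedUnder_le ?_
    refine isBoundedUnder_of ⟨|μ⁻¹|, fun T => ?_⟩
    simp only [Function.comp, Real.norm_eq_abs, abs_mul]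
    exact mul_le_of_le_one_right (abs_nonneg _) (Real.abs_sin_le_one _)

theorem normSq_sum_mul_exp {K : Type*} (s : Finset K) (a f : K → ℝ) (x : ℝ) :
    ‖∑ m ∈ s, (a m : ℂ) * Complex.exp (Complex.I * (x * f m : ℝ))‖ ^ 2
      = ∑ m ∈ s, ∑ m' ∈ s, a m * a m' * Real.cos (x * (f m - f m')) := by
  rw [Complex.sq_norm, Complex.normSq_apply]
  have hre : (∑ m ∈ s, (a m : ℂ) * Complex.exp (Complex.I * (x * f m : ℝ))).re
      = ∑ m ∈ s, a m * Real.cos (x * f m) := by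
    rw [Complex.re_sum]
    refine Finset.sum_congr rfl fun m _ => ?_
    rw [Complex.re_ofReal_mul, mul_comm Complex.I, Complex.exp_ofReal_mul_I_re]
  have him : (∑ m ∈ s, (a m : ℂ) * Complex.exp (Complex.I * (x * f m : ℝ))).im
      = ∑ m ∈ s, a m * Real.sin (x * f m) := by
    rw [Complex.im_sum]
    refine Finset.sum_congr rfl fun m _ => ?_
    rw [Complex.im_ofReal_mul, mul_comm Complex.I, Complex.exp_ofReal_mul_I_im]
  rw [hre, him, Finset.sum_mul_sum, Finset.sum_mul_sum, ← Finset.sum_add_distrib]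
  refine Finset.sum_congr rfl fun m _ => ?_
  rw [← Finset.sum_add_distrib]
  refine Finset.sum_congr rfl fun m' _ => ?_
  rw [mul_sub, Real.cos_sub]
  ring

/-- A bound for an exponential sum bounds its mean square, which is at least the sum of the squares
of the coefficients if coefficients of equal frequencies have the same sign. -/
theorem sum_sq_le_of_norm_sum_mul_exp_le {K : Type*} (s : Finset K) (a f : K → ℝ) {B : ℝ}
    (hsign : ∀ m ∈ s, ∀ m' ∈ s, f m = f m' → 0 ≤ a m * a m')
    (hB : ∀ x : ℝ, 0 < x →
      ‖∑ m ∈ s, (a m : ℂ) * Complex.exp (Complex.I * (x * f m : ℝ))‖ ≤ B) :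
    ∑ m ∈ s, a m ^ 2 ≤ B ^ 2 := by
  classical
  have hlim : Tendsto (fun T : ℝ => ∑ m ∈ s, ∑ m' ∈ s, a m * a m' *
      (T⁻¹ * ∫ x in (0 : ℝ)..T, Real.cos (x * (f m - f m')))) atTop
      (𝓝 (∑ m ∈ s, ∑ m' ∈ s, a m * a m' * if f m - f m' = 0 then 1 else 0)) :=
    tendsto_finsetSum _ fun m _ => tendsto_finsetSum _ fun m' _ =>
      (tendsto_average_cos _).const_mul _
  have hle : ∑ m ∈ s, ∑ m' ∈ s, a m * a m' * (if f m - f m' = 0 then 1 else 0) ≤ B ^ 2 := by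
    refine le_of_tendsto hlim ?_
    filter_upwards [eventually_gt_atTop 0] with T hT
    have hcont (m m' : K) : Continuous fun x : ℝ => Real.cos (x * (f m - f m')) := by fun_prop
    have hint : ∑ m ∈ s, ∑ m' ∈ s, a m * a m' *
        (T⁻¹ * ∫ x in (0 : ℝ)..T, Real.cos (x * (f m - f m')))
        = T⁻¹ * ∫ x in (0 : ℝ)..T, ∑ m ∈ s, ∑ m' ∈ s, a m * a m' * Real.cos (x * (f m - f m')) := by
      rw [intervalIntegral.integral_finsetSum fun m _ => Continuous.intervalIntegrable
        (by fun_prop) _ _, Finset.mul_sum]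
      refine Finset.sum_congr rfl fun m _ => ?_
      rw [intervalIntegral.integral_finsetSum fun m _ => Continuous.intervalIntegrable
        (by fun_prop) _ _, Finset.mul_sum]
      refine Finset.sum_congr rfl fun m' _ => ?_
      rw [intervalIntegral.integral_const_mul]
      ring
    rw [hint, inv_mul_le_iff₀ hT]
    calc _ ≤ ∫ x in (0 : ℝ)..T, B ^ 2 := by
          refine intervalIntegral.integral_mono_on_of_le_Ioo hT.le
            (Continuous.intervalIntegrable (by fun_prop) _ _) (by simp) fun x hx => ?_
          rw [← normSq_sum_mul_exp]
          exact pow_le_pow_left₀ (norm_nonneg _) (hB x hx.1) 2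
      _ = T * B ^ 2 := by simp
  -- By `hsign` the surviving off-diagonal terms are nonnegative, so only the diagonal is kept.
  refine le_trans (Finset.sum_le_sum fun m hm => ?_) hle
  calc a m ^ 2 = a m * a m * (if f m - f m = 0 then 1 else 0) := by simp [sq]
    _ ≤ _ := Finset.single_le_sum (f := fun m' => a m * a m' * (if f m - f m' = 0 then 1 else 0))
        (fun m' hm' => by
          split_ifs with h
          · simpa using hsign m hm m' hm' (sub_eq_zero.1 h)
          · simp) hm

theorem card_piAntidiag_univ_le {J : Type*} [Fintype J] [DecidableEq J] (q : ℕ) :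
    ((Finset.univ : Finset J).piAntidiag q).card ≤ (q + 1) ^ Fintype.card J := by
  have hsub : (Finset.univ : Finset J).piAntidiag q ⊆
      Fintype.piFinset fun _ => Finset.range (q + 1) := by
    intro m hm
    rw [Finset.mem_piAntidiag] at hm
    simp only [Fintype.mem_piFinset, Finset.mem_range, Nat.lt_succ_iff]
    intro j
    rw [← hm.1]
    exact Finset.single_le_sum (fun _ _ => Nat.zero_le _) (Finset.mem_univ j)
  simpa [Fintype.card_piFinset] using Finset.card_le_card hsub

/-- Kronecker-type approximation: the supremum over `x > 0` of a signed convex combination of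
exponentials is `1` if the signs are compatible with the relations between the frequencies. -/
theorem exists_lt_norm_sum_mul_exp {J : Type*} [Fintype J] (w s θ : J → ℝ)
    (hw : ∀ j, 0 ≤ w j) (hw1 : ∑ j, w j = 1)
    (hrel : ∀ m m' : J → ℕ, (∀ j, w j = 0 → m j = 0) → (∀ j, w j = 0 → m' j = 0) →
      ∑ j, m j * θ j = ∑ j, m' j * θ j → 0 < (∏ j, s j ^ m j) * ∏ j, s j ^ m' j)
    (hs : ∀ j, s j ^ 2 = 1) {ε : ℝ} (hε : 0 < ε) :
    ∃ x : ℝ, 0 < x ∧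
      1 - ε < ‖∑ j, ((s j * w j : ℝ) : ℂ) * Complex.exp (Complex.I * (x * θ j : ℝ))‖ := by
  classical
  by_contra! hcon
  set F : ℝ → ℂ := fun x => ∑ j, ((s j * w j : ℝ) : ℂ) * Complex.exp (Complex.I * (x * θ j : ℝ))
    with hF
  have hr0 : 0 ≤ 1 - ε := (norm_nonneg _).trans (hcon 1 one_pos)
  -- Expand `F ^ q` by the multinomial theorem. The weights `W m` sum to 1 and there are at most `(q
  -- + 1) ^ |J|` of them, so by Cauchy–Schwarz the sum of their squares is only polynomially small,
  -- whereas the assumed bound on `F` makes it exponentially small.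
  have hmain (q : ℕ) : 1 ≤ ((q : ℝ) + 1) ^ Fintype.card J * ((1 - ε) ^ 2) ^ q := by
    let K := (Finset.univ : Finset J).piAntidiag q
    let W : (J → ℕ) → ℝ := fun m => Nat.multinomial Finset.univ m * ∏ j, w j ^ m j
    let σ : (J → ℕ) → ℝ := fun m => ∏ j, s j ^ m j
    have hW0 (m : J → ℕ) : 0 ≤ W m :=
      mul_nonneg (Nat.cast_nonneg _) (Finset.prod_nonneg fun j _ => pow_nonneg (hw j) _)
    have hWsum : ∑ m ∈ K, W m = 1 := by
      rw [← Finset.sum_pow_eq_sum_piAntidiag, hw1, one_pow]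
    have hσ (m : J → ℕ) : σ m ^ 2 = 1 := by
      simp only [σ, ← Finset.prod_pow]
      refine Finset.prod_eq_one fun j _ => ?_
      rw [← pow_mul, mul_comm, pow_mul, hs, one_pow]
    have hFq (x : ℝ) : F x ^ q = ∑ m ∈ K, ((σ m * W m : ℝ) : ℂ) *
        Complex.exp (Complex.I * (x * ∑ j, m j * θ j : ℝ)) := by
      rw [hF, Finset.sum_pow_eq_sum_piAntidiag]
      refine Finset.sum_congr rfl fun m _ => ?_
      have hexp : Complex.exp (Complex.I * (x * ∑ j, m j * θ j : ℝ)) =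
          ∏ j, Complex.exp (Complex.I * (x * θ j : ℝ)) ^ m j := by
        simp_rw [← Complex.exp_nat_mul, ← Complex.exp_sum]
        push_cast
        rw [Finset.mul_sum, Finset.mul_sum]
        exact congrArg _ (Finset.sum_congr rfl fun j _ => by ring)
      rw [hexp]
      simp only [σ, W, mul_pow, Finset.prod_mul_distrib]
      push_cast
      simp only [mul_pow, Finset.prod_mul_distrib]
      ring
    have hsq := sum_sq_le_of_norm_sum_mul_exp_le K (fun m => σ m * W m)
      (fun m => ∑ j, m j * θ j) (B := (1 - ε) ^ q) ?_ ?_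
    · have hcs := sq_sum_le_card_mul_sum_sq (s := K) (f := W)
      have hcard : (K.card : ℝ) ≤ ((q : ℝ) + 1) ^ Fintype.card J := by
        exact_mod_cast card_piAntidiag_univ_le (J := J) q
      simp only [mul_pow, hσ, one_mul] at hsq
      rw [hWsum, one_pow] at hcs
      refine hcs.trans (mul_le_mul hcard ?_ (Finset.sum_nonneg fun _ _ => sq_nonneg _)
        (by positivity))
      rwa [← pow_mul, mul_comm 2 q, pow_mul]
    · intro m _ m' _ h
      -- `hrel` speaks only of exponents supported where `w` is nonzero; the other terms have `W m =
      -- 0`.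
      have hsupp {m : J → ℕ} (hm : W m ≠ 0) (j : J) (hj : w j = 0) : m j = 0 := by
        by_contra hne
        refine hm (mul_eq_zero_of_right _ (Finset.prod_eq_zero (Finset.mem_univ j) ?_))
        rw [hj, zero_pow hne]
      by_cases hm : W m = 0
      · simp [hm]
      by_cases hm' : W m' = 0
      · simp [hm']
      have := (hrel m m' (hsupp hm) (hsupp hm') h).le
      calc (0 : ℝ) ≤ (σ m * σ m') * (W m * W m') := mul_nonneg this (mul_nonneg (hW0 _) (hW0 _))
        _ = _ := by ring
    · intro x hx
      rw [← hFq, norm_pow]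
      exact pow_le_pow_left₀ (norm_nonneg _) (hcon x hx) q
  have hlim : Tendsto (fun q : ℕ => ((q : ℝ) + 1) ^ Fintype.card J * ((1 - ε) ^ 2) ^ q) atTop
      (𝓝 0) := by
    have hr : (1 - ε) ^ 2 < 1 := by nlinarith
    -- The factor `2 ^ |J|` comes from `q + 1 ≤ 2 q` for `q ≥ 1`.
    have h := (tendsto_pow_const_mul_const_pow_of_abs_lt_one (Fintype.card J)
      (abs_lt.2 ⟨by nlinarith, hr⟩)).const_mul ((2 : ℝ) ^ Fintype.card J)
    rw [mul_zero] at h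
    refine squeeze_zero' (Eventually.of_forall fun q => by positivity) ?_ h
    filter_upwards [eventually_ge_atTop 1] with q hq
    have hq' : (1 : ℝ) ≤ q := by exact_mod_cast hq
    rw [← mul_assoc, ← mul_pow]
    gcongr
    linarith
  exact absurd (ge_of_tendsto' hlim hmain) (by norm_num)

/-! ### Integer relations between the eigenvalues -/

open Polynomial in
-- With `N = 2 ^ t * p`, a degree count identifies the `2N`-th cyclotomic polynomial with `Ψ = (X ^
-- N + 1) / (X ^ (2 ^ t) + 1)`. Hence `f = Ψ g` with `deg g < 2 ^ t`, and `(X ^ (2 ^ t) + 1) f = (X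
-- ^ N + 1) g` has no terms in degrees from `2 ^ t` to `N - 1`.
theorem coeff_add_eq_zero_of_aeval_eq_zero {p t : ℕ} (hp : p.Prime) (hp_odd : Odd p)
    {ζ : ℂ} (hζ : IsPrimitiveRoot ζ (2 * (2 ^ t * p))) {f : ℚ[X]}
    (hdeg : f.natDegree < 2 ^ t * p) (hf : aeval ζ f = 0) {k : ℕ} (hk : k + 2 ^ t < 2 ^ t * p) :
    f.coeff (k + 2 ^ t) = -f.coeff k := by
  have hN : 0 < 2 ^ t * p := Nat.mul_pos (by positivity) hp.pos
  have h2t : 0 < 2 ^ t := by positivity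
  have hζN : ζ ^ (2 ^ t * p) = -1 := by
    have h := hζ.pow (by omega) (mul_comm 2 (2 ^ t * p))
    exact h.eq_neg_one_of_two_right
  obtain ⟨Ψ, hΨ⟩ : (X ^ (2 ^ t) + 1 : ℚ[X]) ∣ X ^ (2 ^ t * p) + 1 := by
    simpa [pow_mul] using hp_odd.add_dvd_pow_add_pow (X ^ (2 ^ t) : ℚ[X]) 1
  have hm1 : (X ^ (2 ^ t) + 1 : ℚ[X]).Monic := by
    simpa using monic_X_pow_add_C (1 : ℚ) h2t.ne'
  have hm2 : (X ^ (2 ^ t * p) + 1 : ℚ[X]).Monic := by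
    simpa using monic_X_pow_add_C (1 : ℚ) hN.ne'
  have hd1 : (X ^ (2 ^ t) + 1 : ℚ[X]).natDegree = 2 ^ t := by
    simpa using natDegree_X_pow_add_C (n := 2 ^ t) (r := (1 : ℚ))
  have hd2 : (X ^ (2 ^ t * p) + 1 : ℚ[X]).natDegree = 2 ^ t * p := by
    simpa using natDegree_X_pow_add_C (n := 2 ^ t * p) (r := (1 : ℚ))
  have hΨm : Ψ.Monic := hm1.of_mul_monic_left (hΨ ▸ hm2)
  have hΨd : 2 ^ t + Ψ.natDegree = 2 ^ t * p := by
    rw [← hd2, hΨ, hm1.natDegree_mul hΨm, hd1]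
  have hne : ζ ^ (2 ^ t) + 1 ≠ 0 := by
    intro h
    have h1 : ζ ^ (2 * 2 ^ t) = 1 := by
      rw [mul_comm, pow_mul, eq_neg_of_add_eq_zero_left h]; norm_num
    have h2 := Nat.le_of_dvd (by positivity) (hζ.dvd_of_pow_eq_one _ h1)
    have h3 := hp.two_le
    nlinarith
  have hΨ0 : aeval ζ Ψ = 0 := by
    have h := congrArg (aeval ζ) hΨ
    simp only [map_add, map_mul, map_pow, aeval_X, map_one, hζN] at h
    rw [neg_add_cancel, eq_comm, mul_eq_zero] at h
    exact h.resolve_left hne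
  have hmin := cyclotomic_eq_minpoly_rat hζ (by omega)
  have hcop : Nat.Coprime (2 ^ (t + 1)) p :=
    Nat.Coprime.pow_left _ (Nat.coprime_two_left.2 hp_odd)
  have hΨc : cyclotomic (2 * (2 ^ t * p)) ℚ = Ψ := by
    refine (eq_of_monic_of_dvd_of_natDegree_le (cyclotomic.monic _ _) hΨm
      (hmin ▸ minpoly.dvd ℚ ζ hΨ0) ?_).symm
    rw [natDegree_cyclotomic, show 2 * (2 ^ t * p) = 2 ^ (t + 1) * p by ring,
      Nat.totient_mul hcop, Nat.totient_prime hp, Nat.totient_prime_pow_succ Nat.prime_two,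
      Nat.add_one_sub_one, mul_one, Nat.mul_sub, mul_one]
    omega
  obtain ⟨g, hg⟩ : Ψ ∣ f := hΨc ▸ hmin ▸ minpoly.dvd ℚ ζ hf
  have hgd : g.natDegree < 2 ^ t := by
    by_cases hg0 : g = 0
    · simp [hg0]
    · rw [hg, hΨm.natDegree_mul' hg0] at hdeg
      omega
  have key : f * X ^ (2 ^ t) + f = g * X ^ (2 ^ t * p) + g := by
    linear_combination (X ^ (2 ^ t) + 1) * hg - g * hΨ
  have h := congrArg (fun q => q.coeff (k + 2 ^ t)) key
  simp only [coeff_add, coeff_mul_X_pow', if_neg (not_le.2 hk), if_pos (Nat.le_add_left _ k),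
    Nat.add_sub_cancel, coeff_eq_zero_of_natDegree_lt (show g.natDegree < k + 2 ^ t by omega)] at h
  linarith

/-- Halve `j`, solve modulo the coprime numbers `2 ^ (t - 1)` and `p`, and double the solution. -/
theorem exists_modEq_two_pow_dvd {p t : ℕ} (hp_odd : Odd p) (ht : 1 ≤ t)
    {j : ℕ} (hj : Even j) :
    ∃ k < 2 ^ t * p, 2 * p ∣ k ∧ k ≡ j [MOD 2 ^ t] := by
  obtain ⟨i, rfl⟩ := hj
  obtain ⟨s, rfl⟩ := Nat.exists_eq_add_of_le' ht
  have hcop : Nat.Coprime (2 ^ s) p := Nat.Coprime.pow_left _ (Nat.coprime_two_left.2 hp_odd)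
  have hp0 : p ≠ 0 := by rintro rfl; simp at hp_odd
  let x := Nat.chineseRemainder hcop i 0
  have hx := Nat.chineseRemainder_lt_mul hcop i 0 (by positivity) hp0
  refine ⟨2 * x, ?_, ?_, ?_⟩
  · calc 2 * (x : ℕ) < 2 * (2 ^ s * p) := by simpa [x] using hx
      _ = 2 ^ (s + 1) * p := by ring
  · exact Nat.mul_dvd_mul_left 2 ((Nat.modEq_zero_iff_dvd).1 x.2.2)
  · have := Nat.ModEq.mul_left' 2 x.2.1
    rwa [← pow_succ', two_mul i] at this

open Polynomial in
/-- Integer relations between the numbers `cos (π k / N)`, `2p ∤ k`, where `N = 2 ^ t * p`, are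
even on the even indices. -/
theorem even_sum_of_sum_mul_cos_eq_zero {p t : ℕ} (hp : p.Prime) (hp_odd : Odd p) (ht : 2 ≤ t)
    (l : ℕ → ℤ) (hl : ∀ k, 2 * p ∣ k → l k = 0)
    (hsum : ∑ k ∈ Finset.range (2 ^ t * p + 1),
      (l k : ℝ) * (2 * Real.cos (Real.pi * k / (2 ^ t * p : ℕ))) = 0) :
    Even (∑ k ∈ Finset.range (2 ^ t * p + 1), ((k : ℤ) + 1) * l k) := by
  obtain ⟨s, rfl⟩ := Nat.exists_eq_add_of_le' ht
  have h2N : 2 * p ∣ 2 ^ (s + 2) * p := ⟨2 ^ (s + 1), by ring⟩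
  have hNhalf : 2 ^ (s + 2) * p = 2 * (2 * p * 2 ^ s) := by ring
  set N := 2 ^ (s + 2) * p with hNdef
  have hN : 0 < N := Nat.mul_pos (by positivity) hp.pos
  have hζ := Complex.isPrimitiveRoot_exp (2 * N) (by omega)
  set ζ := Complex.exp (2 * Real.pi * Complex.I / (2 * N : ℕ)) with hζdef
  have hζ0 : ζ ≠ 0 := Complex.exp_ne_zero _
  have hζN : ζ ^ N = -1 :=
    (hζ.pow (by omega) (mul_comm 2 N)).eq_neg_one_of_two_right
  have hl0 : l 0 = 0 := hl 0 (dvd_zero _)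
  have hlN : l N = 0 := hl N h2N
  have hNC : (N : ℂ) ≠ 0 := by exact_mod_cast hN.ne'
  have hcos (k : ℕ) : ((2 * Real.cos (Real.pi * k / N) : ℝ) : ℂ) = ζ ^ k + (ζ ^ k)⁻¹ := by
    rw [hζdef, ← Complex.exp_nat_mul, ← Complex.exp_neg]
    push_cast
    rw [Complex.two_cos]
    congr 2 <;> field_simp
  -- Since `ζ ^ N = -1`, the inverse of `ζ ^ k` is `-ζ ^ (N - k)`, so the cosine relation says `f(ζ)
  -- = 0`. The coefficient at `N` vanishes because `l 0 = l N = 0`.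
  let f : ℚ[X] := ∑ k ∈ Finset.range (N + 1), C ((l k - l (N - k) : ℤ) : ℚ) * X ^ k
  have hcoeff (k : ℕ) : f.coeff k = if k ≤ N then ((l k - l (N - k) : ℤ) : ℚ) else 0 := by
    simp only [f, finsetSum_coeff, coeff_C_mul_X_pow]
    rw [Finset.sum_ite_eq]
    simp only [Finset.mem_range, Nat.lt_succ_iff]
  have hdeg : f.natDegree < N := by
    refine Nat.lt_of_le_pred hN (natDegree_le_iff_coeff_eq_zero.2 fun k hk => ?_)
    rw [hcoeff]
    split_ifs with h
    · obtain rfl : k = N := by rw [Nat.pred_eq_sub_one] at hk; omega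
      simp [hl0, hlN]
    · rfl
  have hf : aeval ζ f = 0 := by
    have h1 : aeval ζ f = ∑ k ∈ Finset.range (N + 1), (l k : ℂ) * ζ ^ k
        - ∑ k ∈ Finset.range (N + 1), (l (N - k) : ℂ) * ζ ^ k := by
      simp [f, sub_mul, Finset.sum_sub_distrib]
    have h2 : ∑ k ∈ Finset.range (N + 1), (l (N - k) : ℂ) * ζ ^ k
        = - ∑ k ∈ Finset.range (N + 1), (l k : ℂ) * (ζ ^ k)⁻¹ := by
      rw [← Finset.sum_flip, ← Finset.sum_neg_distrib]
      refine Finset.sum_congr rfl fun k hk => ?_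
      have hk' : k ≤ N := Nat.lt_succ_iff.1 (Finset.mem_range.1 hk)
      rw [Nat.sub_sub_self hk', pow_sub₀ _ hζ0 hk', hζN]
      ring
    rw [h1, h2, sub_neg_eq_add, ← Finset.sum_add_distrib]
    have h3 := congrArg (fun x : ℝ => (x : ℂ)) hsum
    simp only [Complex.ofReal_sum, Complex.ofReal_mul _ (2 * _), hcos, Complex.ofReal_zero] at h3
    rw [← h3]
    refine Finset.sum_congr rfl fun k _ => ?_
    push_cast
    ring
  have hper {k : ℕ} (i : ℕ) (hk : k + 2 ^ (s + 2) * i < N) :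
      f.coeff (k + 2 ^ (s + 2) * i) = 0 ↔ f.coeff k = 0 := by
    induction i with
    | zero => simp
    | succ i ih =>
      rw [mul_add, mul_one, ← add_assoc] at hk ⊢
      rw [coeff_add_eq_zero_of_aeval_eq_zero hp hp_odd hζ hdeg hf hk, neg_eq_zero,
        ih ((Nat.le_add_right _ _).trans_lt hk)]
  have hmod {k : ℕ} (hk : k < N) : f.coeff k = 0 ↔ f.coeff (k % 2 ^ (s + 2)) = 0 := by
    have := hper (k := k % 2 ^ (s + 2)) (k / 2 ^ (s + 2)) (by rwa [Nat.mod_add_div])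
    rwa [Nat.mod_add_div] at this
  -- The class of an even `k` modulo `2 ^ (s + 2)` contains a multiple `m` of `2p`. There `l m = l
  -- (N - m) = 0`, and antiperiodicity carries this zero of the coefficients of `f` to `k`.
  have hsymm {k : ℕ} (hk : k ≤ N) (hke : Even k) : l k = l (N - k) := by
    rcases hk.eq_or_lt with rfl | hk
    · simp [hl0, hlN]
    obtain ⟨m, hmN, hm, hmk⟩ := exists_modEq_two_pow_dvd hp_odd (by omega : 1 ≤ s + 2) hke
    have h0 : f.coeff m = 0 := by
      simp [hcoeff, hl m hm, hl (N - m) (Nat.dvd_sub h2N hm)]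
    have h1 : f.coeff k = 0 := by
      rw [hmod hk, ← hmk, ← hmod hmN, h0]
    rw [hcoeff, if_pos hk.le] at h1
    have h2 : l k - l (N - k) = 0 := by exact_mod_cast h1
    omega
  rw [← ZMod.intCast_eq_zero_iff_even]
  push_cast
  have hZ2 (x : ZMod 2) : x + x = 0 := CharTwo.add_self_eq_zero x
  have hodd {k : ℕ} (hk : ¬ Even k) : ((k : ZMod 2) + 1) = 0 := by
    have := (ZMod.natCast_eq_zero_iff_even (n := k + 1)).2 (Nat.not_even_iff_odd.1 hk).add_one
    exact_mod_cast this
  have hNe : Even N := ⟨2 * p * 2 ^ s, by omega⟩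
  -- Modulo 2 the terms with odd `k` vanish and those with even `k` cancel in pairs. The fixed point
  -- `N / 2 = 2 * p * 2 ^ s` is a multiple of `2p`, which is where `2 ≤ t` enters, so `l` vanishes
  -- there.
  refine Finset.sum_involution (fun k _ => N - k) ?_ ?_ ?_ ?_
  · intro k hk
    have hk' : k ≤ N := Nat.lt_succ_iff.1 (Finset.mem_range.1 hk)
    by_cases hke : Even k
    · have hke' : Even (N - k) := (Nat.even_sub hk').2 (by tauto)
      rw [← hsymm hk' hke, (ZMod.natCast_eq_zero_iff_even).2 hke,
        (ZMod.natCast_eq_zero_iff_even).2 hke', hZ2]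
    · have hke' : ¬ Even (N - k) := fun h => hke (((Nat.even_sub hk').1 h).1 hNe)
      rw [hodd hke, hodd hke']; ring
  · intro k hk hne h
    apply hne
    have hk' : k ≤ N := Nat.lt_succ_iff.1 (Finset.mem_range.1 hk)
    rw [hl k ⟨2 ^ s, by omega⟩]
    simp
  · intro k hk
    simp only [Finset.mem_range]; omega
  · intro k hk
    have hk' : k ≤ N := Nat.lt_succ_iff.1 (Finset.mem_range.1 hk)
    omega

/-! ### Spectral decomposition of the path -/

/-- The matrix of the (unnormalized) discrete sine transform. -/
noncomputable def sineMatrix (n : ℕ) : Matrix (Fin n) (Fin n) ℂ :=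
  Matrix.of fun j k =>
    ((Real.sin (Real.pi * ((j : ℕ) + 1 : ℕ) * ((k : ℕ) + 1 : ℕ) / (n + 1 : ℕ)) : ℝ) : ℂ)

/-- The eigenvalues of the path on `n` vertices. -/
noncomputable def pathEigenvalue (n : ℕ) (j : Fin n) : ℝ :=
  2 * Real.cos (Real.pi * ((j : ℕ) + 1 : ℕ) / (n + 1 : ℕ))

theorem sineMatrix_transpose (n : ℕ) : (sineMatrix n)ᵀ = sineMatrix n := by
  ext j k
  simp only [sineMatrix, transpose_apply, of_apply]
  rw [mul_right_comm]

theorem sineMatrix_star (n : ℕ) (j k : Fin n) : star (sineMatrix n j k) = sineMatrix n j k := by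
  simp only [sineMatrix, of_apply]
  exact Complex.conj_ofReal _

theorem pathEigenvalue_injective (n : ℕ) : Function.Injective (pathEigenvalue n) := by
  intro j k h
  have hn : (0 : ℝ) < (n + 1 : ℕ) := by positivity
  have hmem (j : Fin n) : Real.pi * ((j : ℕ) + 1 : ℕ) / (n + 1 : ℕ) ∈ Set.Icc 0 Real.pi := by
    refine ⟨by positivity, ?_⟩
    rw [div_le_iff₀ hn]
    have : (((j : ℕ) + 1 : ℕ) : ℝ) ≤ (n + 1 : ℕ) := by exact_mod_cast (by omega)
    exact mul_le_mul_of_nonneg_left this Real.pi_pos.le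
  have h1 := Real.injOn_cos (hmem j) (hmem k) (by simpa [pathEigenvalue] using h)
  rw [div_left_inj' hn.ne', mul_right_inj' Real.pi_pos.ne', Nat.cast_inj] at h1
  exact Fin.ext (by omega)

/-- The zeros at the phantom labels `0` and `n + 1` let the end vertices obey the same formula as
inner ones. The element `j` has label `j + 1`, hence neighbouring labels `j` and `j + 2`. -/
theorem sum_adjMatrix_pathGraph_mul {n : ℕ} (g : ℕ → ℂ) (h0 : g 0 = 0) (hn : g (n + 1) = 0)
    (j : Fin n) :
    ∑ k : Fin n, (SimpleGraph.pathGraph n).adjMatrix ℂ j k * g (k + 1) = g j + g (j + 2) := by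
  have h1 (k : Fin n) : (SimpleGraph.pathGraph n).adjMatrix ℂ j k * g (k + 1) =
      (if (k : ℕ) + 1 = j then g (k + 1) else 0) + (if (k : ℕ) = j + 1 then g (k + 1) else 0) := by
    rw [SimpleGraph.adjMatrix_apply]
    simp only [SimpleGraph.pathGraph_adj]
    split_ifs <;> first | omega | simp
  simp_rw [h1]
  rw [Finset.sum_add_distrib]
  congr 1
  · rw [← Finset.sum_range (fun k => if k + 1 = (j : ℕ) then g (k + 1) else 0)]
    obtain ⟨j, hj⟩ := j
    cases j with
    | zero => simp [h0]
    | succ i =>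
      simp only [Nat.add_right_cancel_iff]
      rw [Finset.sum_ite_eq', if_pos (Finset.mem_range.2 (by omega))]
  · rw [← Finset.sum_range (fun k => if k = (j : ℕ) + 1 then g (k + 1) else 0),
      Finset.sum_ite_eq']
    split_ifs with h
    · rfl
    · rw [Finset.mem_range] at h
      rw [← hn, show (j : ℕ) + 2 = n + 1 by omega]

theorem adjMatrix_mul_sineMatrix (n : ℕ) :
    (SimpleGraph.pathGraph n).adjMatrix ℂ * sineMatrix n =
      sineMatrix n * diagonal fun j => (pathEigenvalue n j : ℂ) := by
  ext j k
  rw [mul_diagonal, mul_apply]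
  have hn : ((n + 1 : ℕ) : ℝ) ≠ 0 := by positivity
  have h := sum_adjMatrix_pathGraph_mul (n := n) (fun i =>
    ((Real.sin (Real.pi * (i : ℕ) * ((k : ℕ) + 1 : ℕ) / (n + 1 : ℕ)) : ℝ) : ℂ)) (by simp) (by
      rw [mul_right_comm, mul_div_cancel_right₀ _ hn, mul_comm Real.pi, Real.sin_nat_mul_pi]
      simp) j
  refine h.trans ?_
  simp only [sineMatrix, pathEigenvalue, of_apply]
  rw [← Complex.ofReal_add, ← Complex.ofReal_mul]
  congr 1
  have h1 : Real.pi * (j : ℕ) * ((k : ℕ) + 1 : ℕ) / (n + 1 : ℕ) =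
      Real.pi * ((j : ℕ) + 1 : ℕ) * ((k : ℕ) + 1 : ℕ) / (n + 1 : ℕ) -
        Real.pi * ((k : ℕ) + 1 : ℕ) / (n + 1 : ℕ) := by
    push_cast
    ring
  have h2 : Real.pi * ((j : ℕ) + 2 : ℕ) * ((k : ℕ) + 1 : ℕ) / (n + 1 : ℕ) =
      Real.pi * ((j : ℕ) + 1 : ℕ) * ((k : ℕ) + 1 : ℕ) / (n + 1 : ℕ) +
        Real.pi * ((k : ℕ) + 1 : ℕ) / (n + 1 : ℕ) := by
    push_cast
    ring
  rw [h1, h2, Real.sin_sub, Real.sin_add]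
  ring

/-- The squared norms of the columns of the sine matrix. -/
noncomputable def sineNormSq (n : ℕ) (j : Fin n) : ℝ :=
  ∑ k : Fin n, Real.sin (Real.pi * ((j : ℕ) + 1 : ℕ) * ((k : ℕ) + 1 : ℕ) / (n + 1 : ℕ)) ^ 2

theorem sineNormSq_pos (n : ℕ) (j : Fin n) : 0 < sineNormSq n j := by
  refine Finset.sum_pos' (fun _ _ => sq_nonneg _) ⟨⟨0, j.pos⟩, Finset.mem_univ _, ?_⟩
  refine pow_pos (Real.sin_pos_of_pos_of_lt_pi (by positivity) ?_) 2
  have hn : (0 : ℝ) < (n + 1 : ℕ) := by positivity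
  rw [div_lt_iff₀ hn]
  have : (((j : ℕ) + 1 : ℕ) : ℝ) < (n + 1 : ℕ) := by exact_mod_cast (by omega)
  rw [zero_add, Nat.cast_one, mul_one]
  exact mul_lt_mul_of_pos_left this Real.pi_pos

/-- Orthogonality without evaluating trigonometric sums: by symmetry of `A` and `S`, `A S = S D`
gives `S A = D S`, so `S * S` commutes with `D`, whose diagonal entries are distinct. -/
theorem sineMatrix_mul_self (n : ℕ) :
    sineMatrix n * sineMatrix n = diagonal fun j => (sineNormSq n j : ℂ) := by
  set D : Matrix (Fin n) (Fin n) ℂ := diagonal fun j => (pathEigenvalue n j : ℂ) with hD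
  have hAT : ((SimpleGraph.pathGraph n).adjMatrix ℂ)ᵀ = (SimpleGraph.pathGraph n).adjMatrix ℂ :=
    SimpleGraph.transpose_adjMatrix _
  have hAS := adjMatrix_mul_sineMatrix n
  have hSA : sineMatrix n * (SimpleGraph.pathGraph n).adjMatrix ℂ = D * sineMatrix n := by
    have := congrArg transpose hAS
    rwa [transpose_mul, transpose_mul, hAT, sineMatrix_transpose, diagonal_transpose] at this
  have hcomm : sineMatrix n * sineMatrix n * D = D * (sineMatrix n * sineMatrix n) := by
    rw [Matrix.mul_assoc, ← hAS, ← Matrix.mul_assoc, hSA, Matrix.mul_assoc]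
  ext j k
  by_cases hjk : j = k
  · subst hjk
    rw [diagonal_apply_eq, mul_apply, sineNormSq, Complex.ofReal_sum]
    refine Finset.sum_congr rfl fun k _ => ?_
    nth_rw 2 [← sineMatrix_transpose]
    rw [transpose_apply, ← sq, sineMatrix, of_apply, Complex.ofReal_pow]
  · rw [diagonal_apply_ne _ hjk]
    have h := congrFun (congrFun hcomm j) k
    rw [hD, mul_diagonal, diagonal_mul, mul_comm, ← sub_eq_zero, ← sub_mul, mul_eq_zero,
      sub_eq_zero, Complex.ofReal_inj] at h
    exact h.resolve_left fun h => hjk (pathEigenvalue_injective n h.symm)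

/-- Spectral decomposition of the transition operator of a path. -/
theorem transition_pathGraph (n : ℕ) (τ : ℝ) :
    transition (SimpleGraph.pathGraph n) τ = sineMatrix n *
      diagonal (fun j => Complex.exp (Complex.I * (τ * pathEigenvalue n j : ℝ)) *
        ((sineNormSq n j)⁻¹ : ℝ)) * sineMatrix n := by
  set D : Matrix (Fin n) (Fin n) ℂ := diagonal fun j => (pathEigenvalue n j : ℂ) with hD
  set R : Matrix (Fin n) (Fin n) ℂ :=
    diagonal (fun j => (((sineNormSq n j)⁻¹ : ℝ) : ℂ)) * sineMatrix n with hR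
  have hRS : R * sineMatrix n = 1 := by
    rw [hR, Matrix.mul_assoc, sineMatrix_mul_self, diagonal_mul_diagonal, ← diagonal_one]
    congr 1
    ext j
    rw [← Complex.ofReal_mul, inv_mul_cancel₀ (sineNormSq_pos n j).ne', Complex.ofReal_one]
  have hSR : sineMatrix n * R = 1 := mul_eq_one_comm.1 hRS
  have hinv : (sineMatrix n)⁻¹ = R := inv_eq_left_inv hRS
  have hunit : IsUnit (sineMatrix n) := ⟨⟨_, _, hSR, hRS⟩, rfl⟩
  have hA : (SimpleGraph.pathGraph n).adjMatrix ℂ = sineMatrix n * D * (sineMatrix n)⁻¹ := by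
    rw [← adjMatrix_mul_sineMatrix, hinv, Matrix.mul_assoc, hSR, Matrix.mul_one]
  rw [transition, hA, ← Matrix.smul_mul, ← Matrix.mul_smul, exp_conj _ _ hunit, hD, ← diagonal_smul,
    exp_diagonal, hinv, hR, ← Matrix.mul_assoc, Matrix.mul_assoc (sineMatrix n),
    diagonal_mul_diagonal]
  congr 3
  ext j
  rw [Pi.coe_exp, ← Complex.exp_eq_exp_ℂ]
  simp [mul_assoc]

/-- This is `sin (kπ - x) = -(-1) ^ k sin x` for `k = j + 1`, which accounts for the exponent `j`.
-/
theorem sineMatrix_mulVec_mirror {n : ℕ} (v : Fin n → ℂ) (j : Fin n) :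
    (sineMatrix n *ᵥ mirror v) j = (-1) ^ (j : ℕ) * (sineMatrix n *ᵥ v) j := by
  simp only [mulVec, dotProduct, mirror]
  rw [← Equiv.sum_comp Fin.revPerm, Finset.mul_sum]
  refine Finset.sum_congr rfl fun k _ => ?_
  simp only [Fin.revPerm_apply, Fin.rev_rev]
  rw [← mul_assoc]
  congr 1
  simp only [sineMatrix, of_apply]
  have hn : ((n + 1 : ℕ) : ℝ) ≠ 0 := by positivity
  have hk : (((Fin.rev k : Fin n) : ℕ) + 1 : ℕ) = (n + 1 : ℕ) - (((k : ℕ) + 1 : ℕ) : ℝ) := by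
    rw [← Nat.cast_sub (by omega), Fin.val_rev]
    congr 1
    omega
  have hx : Real.pi * ((j : ℕ) + 1 : ℕ) * (((Fin.rev k : Fin n) : ℕ) + 1 : ℕ) / (n + 1 : ℕ) =
      ((j : ℕ) + 1 : ℕ) * Real.pi -
        Real.pi * ((j : ℕ) + 1 : ℕ) * ((k : ℕ) + 1 : ℕ) / (n + 1 : ℕ) := by
    rw [hk]
    field_simp
  rw [hx, Real.sin_nat_mul_pi_sub]
  push_cast
  ring

/-- The weight of a vector in the `j`-th eigenspace of the path. -/
noncomputable def spectralWeight {n : ℕ} (v : Fin n → ℂ) (j : Fin n) : ℝ :=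
  ‖(sineMatrix n *ᵥ v) j‖ ^ 2 * (sineNormSq n j)⁻¹

/-- Used with alternating signs `s` for the mirror state, and with `s = 1`, `τ = 0` to see that the
weights of a state sum to 1. -/
theorem star_dotProduct_transition_mulVec {n : ℕ} {v w : Fin n → ℂ} (s : Fin n → ℝ)
    (hw : ∀ j, (sineMatrix n *ᵥ w) j = s j * (sineMatrix n *ᵥ v) j) (τ : ℝ) :
    star w ⬝ᵥ (transition (SimpleGraph.pathGraph n) τ *ᵥ v) =
      ∑ j, ((s j * spectralWeight v j : ℝ) : ℂ) *
        Complex.exp (Complex.I * (τ * pathEigenvalue n j : ℝ)) := by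
  have hSH : (sineMatrix n)ᴴ = sineMatrix n := by
    ext j k
    rw [conjTranspose_apply, sineMatrix_star, ← transpose_apply (sineMatrix n), sineMatrix_transpose]
  rw [transition_pathGraph, Matrix.mul_assoc, ← mulVec_mulVec, dotProduct_mulVec]
  nth_rw 1 [← hSH]
  rw [← star_mulVec, ← mulVec_mulVec, dotProduct]
  refine Finset.sum_congr rfl fun j _ => ?_
  rw [mulVec_diagonal, Pi.star_apply, hw, star_mul', spectralWeight]
  have h1 : star ((sineMatrix n *ᵥ v) j) * (sineMatrix n *ᵥ v) j =
      ((‖(sineMatrix n *ᵥ v) j‖ ^ 2 : ℝ) : ℂ) := by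
    rw [Complex.ofReal_pow, ← Complex.conj_mul']; rfl
  have h2 : star (s j : ℂ) = s j := Complex.conj_ofReal _
  rw [h2, Complex.ofReal_mul (s j), Complex.ofReal_mul (‖_‖ ^ 2), ← h1]
  ring

theorem star_dotProduct_self_eq {n : ℕ} (v : Fin n → ℂ) :
    star v ⬝ᵥ v = ((∑ j, ‖v j‖ ^ 2 : ℝ) : ℂ) := by
  rw [dotProduct, Complex.ofReal_sum]
  refine Finset.sum_congr rfl fun j _ => ?_
  rw [Complex.ofReal_pow, ← Complex.conj_mul']; rfl

theorem sum_spectralWeight {n : ℕ} {v : Fin n → ℂ} (hv : IsState v) :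
    ∑ j, spectralWeight v j = 1 := by
  have h := star_dotProduct_transition_mulVec (v := v) (w := v) (fun _ => 1) (by simp) 0
  have h0 : transition (SimpleGraph.pathGraph n) 0 = 1 := by simp [transition]
  rw [h0, one_mulVec, star_dotProduct_self_eq, hv] at h
  simp only [one_mul, zero_mul, Complex.ofReal_zero, mul_zero, Complex.exp_zero, mul_one] at h
  exact_mod_cast h.symm

theorem spectralWeight_nonneg {n : ℕ} (v : Fin n → ℂ) (j : Fin n) : 0 ≤ spectralWeight v j :=
  mul_nonneg (sq_nonneg _) (inv_nonneg.2 (sineNormSq_pos n j).le)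

theorem IsState.mirror {n : ℕ} {v : Fin n → ℂ} (hv : IsState v) : IsState (mirror v) := by
  rw [IsState, ← Equiv.sum_comp Fin.revPerm]
  simp only [StateTransfer.mirror, Fin.revPerm_apply, Fin.rev_rev]
  exact hv

/-! ### Pair states and their spectral support -/

theorem sum_mul_ket {n a : ℕ} (ha : 1 ≤ a) (han : a ≤ n) (g : ℕ → ℂ) :
    ∑ k : Fin n, g (k + 1) * ket n a k = g a := by
  rw [Finset.sum_eq_single ⟨a - 1, by omega⟩]
  · simp [ket, Nat.sub_add_cancel ha]
  · intro k _ hk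
    have : (k : ℕ) + 1 ≠ a := fun h => hk (Fin.ext (by simp; omega))
    simp [ket, this]
  · simp

theorem isState_pairState {n a b : ℕ} {α : ℤ} (ha : 1 ≤ a) (han : a ≤ n) (hb : 1 ≤ b)
    (hbn : b ≤ n) (hab : a ≠ b) (hα : α = 1 ∨ α = -1) : IsState (pairState n a b α) := by
  have hα2 : ‖(α : ℂ)‖ = 1 := by rcases hα with rfl | rfl <;> simp
  have h (j : Fin n) : ((‖pairState n a b α j‖ ^ 2 : ℝ) : ℂ) =
      1 / 2 * ket n a j + 1 / 2 * ket n b j := by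
    have hs : ‖((Real.sqrt 2 : ℝ) : ℂ)⁻¹‖ ^ 2 = 1 / 2 := by
      rw [norm_inv, inv_pow, Complex.norm_real, Real.norm_eq_abs, sq_abs]; norm_num
    simp only [pairState, Pi.smul_apply, Pi.add_apply, smul_eq_mul, norm_mul, mul_pow, hs, ket]
    split_ifs
    · omega
    all_goals simp [-Complex.norm_intCast, hα2]
  have h2 : ((∑ j, ‖pairState n a b α j‖ ^ 2 : ℝ) : ℂ) = 1 := by
    rw [Complex.ofReal_sum]
    simp_rw [h]
    rw [Finset.sum_add_distrib, sum_mul_ket ha han (fun _ => 1 / 2),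
      sum_mul_ket hb hbn (fun _ => 1 / 2)]
    norm_num
  exact_mod_cast h2

theorem mirror_pairState {n a b : ℕ} (α : ℤ) (ha : 1 ≤ a) (han : a ≤ n) (hb : 1 ≤ b)
    (hbn : b ≤ n) :
    mirror (pairState n a b α) = pairState n (n + 1 - a) (n + 1 - b) α := by
  have hket {a : ℕ} (ha : 1 ≤ a) (han : a ≤ n) (j : Fin n) :
      ket n a (Fin.rev j) = ket n (n + 1 - a) j := by
    simp only [ket, Fin.val_rev]
    congr 1
    simp only [eq_iff_iff]
    omega
  ext j
  simp only [mirror, pairState, Pi.smul_apply, Pi.add_apply, hket ha han, hket hb hbn]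

/-- If `j + 1 = 2pk`, the sine at label `i` is `sin (2πki / 2 ^ t)`, which depends only on `i`
modulo `2 ^ t`. As `a ≡ -αb`, its value at `a` is `-α` times that at `b`, and the two contributions
cancel. -/
theorem spectralWeight_pairState_eq_zero {n p t a b : ℕ} (hn : 2 ^ t * p = n + 1) (ht : 1 ≤ t)
    (ha : 1 ≤ a) (han : a ≤ n) (hb : 1 ≤ b) (hbn : b ≤ n) {α : ℤ} (hα : α = 1 ∨ α = -1)
    (hmod : (a : ℤ) + α * (b : ℤ) ≡ 0 [ZMOD 2 ^ t]) {j : Fin n} (hj : 2 * p ∣ (j : ℕ) + 1) :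
    spectralWeight (pairState n a b α) j = 0 := by
  let g : ℕ → ℝ := fun i => Real.sin (Real.pi * ((j : ℕ) + 1 : ℕ) * i / (n + 1 : ℕ))
  have hS : (sineMatrix n *ᵥ pairState n a b α) j =
      ((Real.sqrt 2 : ℝ) : ℂ)⁻¹ * ((g a + α * g b : ℝ) : ℂ) := by
    rw [pairState, mulVec_smul, mulVec_add, mulVec_smul]
    have h1 := sum_mul_ket ha han (fun i => (g i : ℂ))
    have h2 := sum_mul_ket hb hbn (fun i => (g i : ℂ))
    push_cast
    rw [← h1, ← h2]
    rfl
  have hg : g a + α * g b = 0 := by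
    obtain ⟨k, hk⟩ := hj
    obtain ⟨c, hc⟩ := (Int.modEq_zero_iff_dvd).1 hmod
    obtain ⟨s, rfl⟩ := Nat.exists_eq_add_of_le' ht
    have hp : (p : ℝ) ≠ 0 := by
      rintro h
      rw [Nat.cast_eq_zero] at h
      simp [h] at hn
    have hx (i : ℕ) : Real.pi * ((j : ℕ) + 1 : ℕ) * i / (n + 1 : ℕ) = Real.pi * k * i / 2 ^ s := by
      rw [hk, ← hn]
      push_cast
      field_simp
      ring
    have hc' : (a : ℝ) = 2 ^ (s + 1) * c - α * b := by
      have : (a : ℝ) + α * b = 2 ^ (s + 1) * c := by exact_mod_cast hc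
      linarith
    have hxa : Real.pi * k * a / 2 ^ s =
        ((k * c : ℤ) : ℝ) * (2 * Real.pi) - α * (Real.pi * k * b / 2 ^ s) := by
      rw [hc']
      push_cast
      field_simp
      ring
    simp only [g, hx]
    rw [hxa, Real.sin_int_mul_two_pi_sub]
    rcases hα with rfl | rfl <;> simp
  rw [spectralWeight, hS, hg]
  simp

/-! ### Transfer to the mirror state -/

theorem prettyGoodStateTransfer_mirror {n p t : ℕ} (hp : p.Prime) (hp_odd : Odd p) (ht : 2 ≤ t)
    (hn : 2 ^ t * p = n + 1) {v : Fin n → ℂ} (hv : IsState v)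
    (hsupp : ∀ j : Fin n, 2 * p ∣ (j : ℕ) + 1 → spectralWeight v j = 0) :
    PrettyGoodStateTransfer (SimpleGraph.pathGraph n) v (mirror v) := by
  refine ⟨hv, hv.mirror, fun ε hε => ?_⟩
  have hS (j : Fin n) : (sineMatrix n *ᵥ mirror v) j =
      (((-1) ^ (j : ℕ) : ℝ) : ℂ) * (sineMatrix n *ᵥ v) j := by
    rw [sineMatrix_mulVec_mirror]
    push_cast
    rfl
  simp_rw [star_dotProduct_transition_mulVec _ hS]
  refine exists_lt_norm_sum_mul_exp _ (fun j : Fin n => (-1) ^ (j : ℕ)) _ (spectralWeight_nonneg v)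
    (sum_spectralWeight hv) ?_ (fun j => by rw [← pow_mul, mul_comm, pow_mul]; simp) hε
  intro m m' hm hm' hmm
  -- The relation `m - m'`, moved from indices to labels and extended by zero to `0` and `n + 1 =
  -- N`.
  let l : ℕ → ℤ := fun k => if h : 1 ≤ k ∧ k ≤ n then
    (m ⟨k - 1, by omega⟩ : ℤ) - m' ⟨k - 1, by omega⟩ else 0
  have hl0 : l 0 = 0 := by simp [l]
  have hln : l (n + 1) = 0 := by simp [l]
  have hlj (j : Fin n) : l (j + 1) = (m j : ℤ) - m' j := by
    simp [l, Nat.succ_le_iff]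
  have hl (k : ℕ) (hk : 2 * p ∣ k) : l k = 0 := by
    by_cases h : 1 ≤ k ∧ k ≤ n
    · obtain ⟨j, rfl⟩ := Nat.exists_eq_add_of_le' h.1
      have hw := hsupp ⟨j, by omega⟩ hk
      rw [hlj ⟨j, by omega⟩, hm _ hw, hm' _ hw, sub_self]
    · simp only [l, dif_neg h]
  have heven := even_sum_of_sum_mul_cos_eq_zero hp hp_odd ht l hl (by
    rw [hn, Finset.sum_range_succ, Finset.sum_range_succ', hl0, hln, Finset.sum_range]
    simp only [hlj]
    have h : ∑ j, ((m j : ℝ) - m' j) * pathEigenvalue n j = 0 := by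
      simp only [sub_mul, Finset.sum_sub_distrib, hmm, sub_self]
    simpa [pathEigenvalue] using h)
  rw [hn, Finset.sum_range_succ, Finset.sum_range_succ', hl0, hln, Finset.sum_range] at heven
  simp only [hlj, mul_zero, add_zero] at heven
  simp only [← pow_mul, Finset.prod_pow_eq_pow_sum, ← pow_add]
  -- The label is `k = j + 1`, so the weight `k + 1 = j + 2` in `heven` has the parity of `j`; also
  -- `m + m'` and `m - m'` agree modulo 2.
  have h2 : Even (∑ j : Fin n, (j : ℕ) * m j + ∑ j : Fin n, (j : ℕ) * m' j) := by
    rw [← Int.even_coe_nat]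
    have h3 : ((∑ j : Fin n, (j : ℕ) * m j + ∑ j : Fin n, (j : ℕ) * m' j : ℕ) : ℤ) =
        ∑ j : Fin n, ((((j : ℕ) + 1 : ℕ) : ℤ) + 1) * ((m j : ℤ) - m' j) +
          2 * ∑ j : Fin n, (((j : ℕ) + 1) * m' j - (m j : ℤ)) := by
      push_cast
      rw [Finset.mul_sum, ← Finset.sum_add_distrib, ← Finset.sum_add_distrib]
      exact Finset.sum_congr rfl fun j _ => by ring
    rw [h3]
    exact heven.add (even_two_mul _)
  rw [h2.neg_one_pow]
  exact one_pos

end StateTransfer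

theorem mainTheorem4 (p t : ℕ) (hp : p.Prime) (hp_odd : Odd p) (ht : 2 ≤ t)
    (a b : ℕ) (ha : 1 ≤ a) (han : a ≤ 2 ^ t * p - 1) (hb : 1 ≤ b) (hbn : b ≤ 2 ^ t * p - 1)
    (hab : a ≠ b) (α : ℤ) (hα : α = 1 ∨ α = -1)
    (hmod : (a : ℤ) + α * (b : ℤ) ≡ 0 [ZMOD 2 ^ t]) :
    StateTransfer.mirror (StateTransfer.pairState (2 ^ t * p - 1) a b α) =
        StateTransfer.pairState (2 ^ t * p - 1) (2 ^ t * p - a) (2 ^ t * p - b) α ∧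
      StateTransfer.PrettyGoodStateTransfer (SimpleGraph.pathGraph (2 ^ t * p - 1))
        (StateTransfer.pairState (2 ^ t * p - 1) a b α)
        (StateTransfer.mirror (StateTransfer.pairState (2 ^ t * p - 1) a b α)) := by
  obtain ⟨n, hn⟩ : ∃ n, 2 ^ t * p = n + 1 :=
    Nat.exists_eq_succ_of_ne_zero (Nat.mul_pos (by positivity) hp.pos).ne'
  have hn' : 2 ^ t * p - 1 = n := by omega
  rw [hn'] at han hbn ⊢
  refine ⟨?_, ?_⟩
  · rw [hn]
    exact StateTransfer.mirror_pairState α ha han hb hbn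
  · exact StateTransfer.prettyGoodStateTransfer_mirror hp hp_odd ht hn
      (StateTransfer.isState_pairState ha han hb hbn hab hα) fun j hj =>
      StateTransfer.spectralWeight_pairState_eq_zero hn (by omega) ha han hb hbn hα hmod hj
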